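/- \textbf{Local speed of convergence of the split optimal policy iteration, continuous time.} Let $A\in\mathbb R^{m\times m}$, $B\in\mathbb R^{m\times r}$, let $Q\in\mathbb R^{m\times m}$ and $R\in\mathbb R^{r\times r}$ be symmetric positive definite, and let $R$ be block diagonal with respect to a decomposition of the $r$ control variables into $n$ blocks (the subsystems). Let $\Pi_i=(0,\dots,0,I,0,\dots,0)^{\rm T}$ be the block column with the identity in the $i$-th block. Let $P^{\rm opt}$ be the symmetric positive definite solution of the Riccati equation \[ A^{\rm T}P+PA-PBR^{-1}B^{\rm T}P+Q=0 \] (assumed to exist), and let $F^{\rm opt}=-R^{-1}B^{\rm T}P^{\rm opt}$ be the optimal feedback matrix. For $F\in\mathbb R^{r\times m}$ and $i\in\{1,\dots,n\}$ put \[ A^{(i)}=A+B(I-\Pi_i\Pi_i^{\rm T})F,\quad B^{(i)}=B\Pi_i,\quad Q^{(i)}=Q+F^{\rm T}(I-\Pi_i\Pi_i^{\rm T})R(I-\Pi_i\Pi_i^{\rm T})F,\quad R^{(i)}=\Pi_i^{\rm T}R\Pi_i . \] The update of subsystem $i$ replaces $F$ by the matrix $F^{\rm new}$ with \[ \Pi_i^{\rm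 T}F^{\rm new}=-(R^{(i)})^{-1}(B^{(i)})^{\rm T}P^{\rm new},\qquad (I-\Pi_i\Pi_i^{\rm T})F^{\rm new}=(I-\Pi_i\Pi_i^{\rm T})F, \] where $P^{\rm new}$ is the symmetric positive definite solution of the Riccati equation for $(A^{(i)},B^{(i)},Q^{(i)},R^{(i)})$. The split optimal policy iteration started at $F^0$ with subsystem $j$ produces $F^1,F^2,\dots$ by updating the subsystems $j,j+1,\dots,n,1,2,\dots$ cyclically, one in each step. Let $\|\cdot\|$ be any norm on $\mathbb R^{r\times m}$. Then the iteration converges locally quadratically: there are $C>0$ and $\varepsilon>0$, depending only on the data $(A,B,Q,R)$, the block decomposition and the norm, such that for every first subsystem $j$ (i) for all iterates $(F^k)_{k\ge 0}$ of the iteration and every $k\ge0$ with $\|F^k-F^{\rm opt}\|<\varepsilon$, \[ \|F^{k+n}-F^{\rm opt}\|\le C\,\|F^k-F^{\rm opt}\|^2 ; \] (ii) if $\|F^0-F^{\rm opt}\|<\varepsilon$, then all the updates starting from $F^0$ exist and are unique, and $F^k\to F^{\rm opt}$ as $k\to\infty$. -/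

import Mathlib

open Matrix

namespace SplitLQR

/-- `P` is a symmetric positive definite solution of the continuous algebraic Riccati equation
`Aᵀ P + P A - P B R⁻¹ Bᵀ P + Q = 0` of the LQR problem `(A, B, Q, R)`. -/
def IsCARESolution {σ ι : Type*} [Fintype σ] [Fintype ι] [DecidableEq ι]
    (A : Matrix σ σ ℝ) (B : Matrix σ ι ℝ) (Q : Matrix σ σ ℝ) (R : Matrix ι ι ℝ)
    (P : Matrix σ σ ℝ) : Prop :=
  P.PosDef ∧ Aᵀ * P + P * A - P * B * R⁻¹ * Bᵀ * P + Q = 0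

/-- The feedback matrix `-R⁻¹ Bᵀ P` that belongs to `P`. -/
noncomputable def feedback {σ ι : Type*} [Fintype σ] [Fintype ι] [DecidableEq ι]
    (B : Matrix σ ι ℝ) (R : Matrix ι ι ℝ) (P : Matrix σ σ ℝ) : Matrix ι σ ℝ :=
  -(R⁻¹ * Bᵀ * P)

/-- Index type of the control vector: `n` blocks, the `i`-th one of size `d i`. -/
abbrev Ctrl {n : ℕ} (d : Fin n → ℕ) : Type := (i : Fin n) × Fin (d i)

/-- The block column `Π_i = (0, …, 0, I, 0, …, 0)ᵀ`. -/
def blockCol {n : ℕ} (d : Fin n → ℕ) (i : Fin n) : Matrix (Ctrl d) (Fin (d i)) ℝ :=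
  Matrix.of fun p a => if p = ⟨i, a⟩ then 1 else 0

/-- The projection `I - Π_i Π_iᵀ` onto the blocks other than the `i`-th one. -/
def compl {n : ℕ} (d : Fin n → ℕ) (i : Fin n) : Matrix (Ctrl d) (Ctrl d) ℝ :=
  1 - blockCol d i * (blockCol d i)ᵀ

section Subproblem

variable {m n : ℕ} {d : Fin n → ℕ}

/-- `A⁽ⁱ⁾ = A + B (I - Π_i Π_iᵀ) F`. -/
def subA (A : Matrix (Fin m) (Fin m) ℝ) (B : Matrix (Fin m) (Ctrl d) ℝ) (i : Fin n)
    (F : Matrix (Ctrl d) (Fin m) ℝ) : Matrix (Fin m) (Fin m) ℝ :=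
  A + B * compl d i * F

/-- `B⁽ⁱ⁾ = B Π_i`. -/
def subB (B : Matrix (Fin m) (Ctrl d) ℝ) (i : Fin n) : Matrix (Fin m) (Fin (d i)) ℝ :=
  B * blockCol d i

/-- `Q⁽ⁱ⁾ = Q + Fᵀ (I - Π_i Π_iᵀ) R (I - Π_i Π_iᵀ) F`. -/
def subQ (Q : Matrix (Fin m) (Fin m) ℝ) (R : Matrix (Ctrl d) (Ctrl d) ℝ) (i : Fin n)
    (F : Matrix (Ctrl d) (Fin m) ℝ) : Matrix (Fin m) (Fin m) ℝ :=
  Q + Fᵀ * compl d i * R * compl d i * F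

/-- `R⁽ⁱ⁾ = Π_iᵀ R Π_i`. -/
def subR (R : Matrix (Ctrl d) (Ctrl d) ℝ) (i : Fin n) : Matrix (Fin (d i)) (Fin (d i)) ℝ :=
  (blockCol d i)ᵀ * R * blockCol d i

/-- `F'` is obtained from `F` by the split optimal policy update of the `i`-th subsystem: the
`i`-th block row of `F'` is the optimal feedback of the LQR problem
`(A⁽ⁱ⁾, B⁽ⁱ⁾, Q⁽ⁱ⁾, R⁽ⁱ⁾)`, and all other block rows are those of `F`. -/
def IsUpdate (A : Matrix (Fin m) (Fin m) ℝ) (B : Matrix (Fin m) (Ctrl d) ℝ)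
    (Q : Matrix (Fin m) (Fin m) ℝ) (R : Matrix (Ctrl d) (Ctrl d) ℝ) (i : Fin n)
    (F F' : Matrix (Ctrl d) (Fin m) ℝ) : Prop :=
  ∃ P : Matrix (Fin m) (Fin m) ℝ,
    IsCARESolution (subA A B i F) (subB B i) (subQ Q R i F) (subR R i) P ∧
    (blockCol d i)ᵀ * F' = feedback (subB B i) (subR R i) P ∧
    compl d i * F' = compl d i * F

end Subproblem

/-- The subsystem updated in step `k` when the updates sweep cyclically through
`0, …, n - 1`, starting with subsystem `j`. -/
def cyclicIndex {n : ℕ} (j : Fin n) (k : ℕ) : Fin n :=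
  ⟨((j : ℕ) + k) % n, Nat.mod_lt _ j.pos⟩

/-- `F 0, F 1, F 2, …` are iterates of the split optimal policy iteration that updates
subsystem `j` first. -/
def IsIteration {m n : ℕ} {d : Fin n → ℕ} (A : Matrix (Fin m) (Fin m) ℝ)
    (B : Matrix (Fin m) (Ctrl d) ℝ) (Q : Matrix (Fin m) (Fin m) ℝ)
    (R : Matrix (Ctrl d) (Ctrl d) ℝ) (j : Fin n) (F : ℕ → Matrix (Ctrl d) (Fin m) ℝ) : Prop :=
  ∀ k : ℕ, IsUpdate A B Q R (cyclicIndex j k) (F k) (F (k + 1))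

end SplitLQR

/-! Write `F = Fopt + D` and look for the solution of the `i`-th Riccati equation in the form `Popt
+ X`. Optimality gives `R * Fopt = -Bᵀ * Popt`, and `R` commutes with the projection `compl d i`.
Hence all terms of order zero and all terms linear in `D` alone cancel (`subproblem_riccati_eq`).
What remains is an equation for `X` with inhomogeneity quadratic in `D`, whose linearization at `X =
0`, `D = 0` is the Lyapunov operator of the optimal closed loop. `Popt` certifies stability of that
loop, so the operator is invertible on symmetric matrices, and a small solution `X = O(‖D‖²)` exists
(`exists_riccati_perturbation`). Positive definite Riccati solutions are unique, so this is the true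
update; the error of the new block is linear in `X`, hence quadratic in `D`.

An update leaves the other blocks alone, so errors are measured by the largest block norm. Near the
optimum this maximum never increases, and after `n` steps every block has been renewed with a
quadratically small error. Equivalence of norms carries the estimate over to `N`. -/

namespace SplitLQR

/-! ### Lyapunov comparison -/

section Lyapunov

lemma isHermitian_iff_transpose_eq {σ : Type*} {X : Matrix σ σ ℝ} : X.IsHermitian ↔ Xᵀ = X := by
  rw [Matrix.IsHermitian, conjTranspose_eq_transpose_of_trivial]

variable {σ : Type*} [Fintype σ]

/-- The smallest generalized eigenvalue of a pencil `X - t P` with `P` positive definite. -/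
lemma exists_posSemidef_sub_smul_singular [Nonempty σ] {P X : Matrix σ σ ℝ} (hP : P.PosDef)
    (hX : X.IsHermitian) :
    ∃ t : ℝ, (X - t • P).PosSemidef ∧ ∃ v : σ → ℝ, v ≠ 0 ∧ (X - t • P) *ᵥ v = 0 := by
  classical
  have hpos : ∀ v : σ → ℝ, v ≠ 0 → 0 < v ⬝ᵥ P *ᵥ v := fun v hv => by
    simpa using hP.dotProduct_mulVec_pos hv
  have hne : ∀ v ∈ Metric.sphere (0 : σ → ℝ) 1, v ≠ 0 := fun v hv h => by simp [h] at hv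
  have hcont : ContinuousOn (fun v : σ → ℝ => (v ⬝ᵥ X *ᵥ v) / (v ⬝ᵥ P *ᵥ v))
      (Metric.sphere 0 1) := by
    refine ContinuousOn.div (Continuous.continuousOn ?_) (Continuous.continuousOn ?_)
      fun v hv => (hpos v (hne v hv)).ne'
    · exact continuous_id.dotProduct (continuous_const.matrix_mulVec continuous_id)
    · exact continuous_id.dotProduct (continuous_const.matrix_mulVec continuous_id)
  obtain ⟨v, hv, hmin⟩ := (isCompact_sphere (0 : σ → ℝ) 1).exists_isMinOn
    (NormedSpace.sphere_nonempty.2 zero_le_one) hcont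
  have hPv := hpos v (hne v hv)
  set t := (v ⬝ᵥ X *ᵥ v) / (v ⬝ᵥ P *ᵥ v) with ht
  have hquad : ∀ w : σ → ℝ, w ⬝ᵥ (X - t • P) *ᵥ w = w ⬝ᵥ X *ᵥ w - t * (w ⬝ᵥ P *ᵥ w) := by
    intro w
    rw [sub_mulVec, dotProduct_sub, smul_mulVec, dotProduct_smul, smul_eq_mul]
  have hsph : ∀ w ∈ Metric.sphere (0 : σ → ℝ) 1, 0 ≤ w ⬝ᵥ (X - t • P) *ᵥ w := by
    intro w hw
    have h : t ≤ (w ⬝ᵥ X *ᵥ w) / (w ⬝ᵥ P *ᵥ w) := hmin hw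
    rw [le_div_iff₀ (hpos w (hne w hw))] at h
    rw [hquad]
    linarith
  have hherm : (X - t • P).IsHermitian := by
    have hPT := isHermitian_iff_transpose_eq.1 hP.isHermitian
    have hXT := isHermitian_iff_transpose_eq.1 hX
    rw [isHermitian_iff_transpose_eq, transpose_sub, transpose_smul, hPT, hXT]
  have hpsd : (X - t • P).PosSemidef := by
    refine PosSemidef.of_dotProduct_mulVec_nonneg hherm fun w => ?_
    rw [star_trivial]
    by_cases hw : w = 0
    · simp [hw]
    have hw' : ‖w‖ ≠ 0 := norm_ne_zero_iff.2 hw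
    have h := hsph (‖w‖⁻¹ • w) (by simp [norm_smul, hw'])
    rw [mulVec_smul, dotProduct_smul, smul_dotProduct, smul_eq_mul, smul_eq_mul, ← mul_assoc] at h
    exact nonneg_of_mul_nonneg_right h (by positivity)
  refine ⟨t, hpsd, v, hne v hv, ?_⟩
  refine (hpsd.dotProduct_mulVec_zero_iff v).1 ?_
  rw [star_trivial, hquad, ht, div_mul_cancel₀ _ hPv.ne', sub_self]

/-- Comparison principle for Lyapunov operators: stability is certified by `P`. -/
lemma posSemidef_of_lyapunov {A P X : Matrix σ σ ℝ} (hP : P.PosDef)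
    (hA : (-(Aᵀ * P + P * A)).PosDef) (hX : X.IsHermitian)
    (hAX : (-(Aᵀ * X + X * A)).PosSemidef) : X.PosSemidef := by
  cases isEmpty_or_nonempty σ
  · rw [Subsingleton.elim X 0]
    exact PosSemidef.zero
  obtain ⟨t, hpsd, v, hv, hker⟩ := exists_posSemidef_sub_smul_singular hP hX
  have hpos := hA.dotProduct_mulVec_pos hv
  have hnonneg := hAX.dotProduct_mulVec_nonneg v
  rw [star_trivial] at hpos hnonneg
  have hT := isHermitian_iff_transpose_eq.1 hpsd.isHermitian
  have hker' : v ᵥ* (X - t • P) = 0 := by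
    rw [← hT, vecMul_transpose, hker]
  -- On the kernel vector `v` the contribution of `X - t • P` vanishes, so the two Lyapunov forms
  -- differ by the factor `t`; their signs force `0 ≤ t`.
  have key : v ⬝ᵥ (-(Aᵀ * X + X * A)) *ᵥ v = t * (v ⬝ᵥ (-(Aᵀ * P + P * A)) *ᵥ v) := by
    have h1 : -(Aᵀ * X + X * A) = t • (-(Aᵀ * P + P * A))
        - (Aᵀ * (X - t • P) + (X - t • P) * A) := by
      simp only [Matrix.mul_sub, Matrix.sub_mul, Matrix.mul_smul, Matrix.smul_mul, smul_neg, smul_add]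
      abel
    have h2 : v ⬝ᵥ (Aᵀ * (X - t • P) + (X - t • P) * A) *ᵥ v = 0 := by
      rw [add_mulVec, dotProduct_add, ← mulVec_mulVec, hker, mulVec_zero, dotProduct_zero,
        dotProduct_mulVec, ← vecMul_vecMul, hker', zero_vecMul, zero_dotProduct, add_zero]
    rw [h1, sub_mulVec, dotProduct_sub, h2, sub_zero, smul_mulVec, dotProduct_smul, smul_eq_mul]
  have ht : 0 ≤ t := by
    rw [key] at hnonneg
    exact nonneg_of_mul_nonneg_left hnonneg hpos
  have := hpsd.add (hP.posSemidef.smul ht)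
  rwa [sub_add_cancel] at this

lemma eq_zero_of_posSemidef_of_neg {X : Matrix σ σ ℝ} (h : X.PosSemidef)
    (h' : (-X).PosSemidef) : X = 0 := by
  classical
  refine Matrix.ext_of_mulVec_single fun i => ?_
  have h1 := h.dotProduct_mulVec_nonneg (Pi.single i 1)
  have h2 := h'.dotProduct_mulVec_nonneg (Pi.single i 1)
  rw [neg_mulVec, dotProduct_neg] at h2
  rw [(h.dotProduct_mulVec_zero_iff _).1 (le_antisymm (by linarith) h1), zero_mulVec]

lemma eq_zero_of_lyapunov_eq_zero {A P X : Matrix σ σ ℝ} (hP : P.PosDef)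
    (hA : (-(Aᵀ * P + P * A)).PosDef) (hX : X.IsHermitian)
    (hAX : Aᵀ * X + X * A = 0) : X = 0 := by
  refine eq_zero_of_posSemidef_of_neg (posSemidef_of_lyapunov hP hA hX ?_)
    (posSemidef_of_lyapunov hP hA hX.neg ?_)
  · rw [hAX, neg_zero]; exact PosSemidef.zero
  · rw [mul_neg, neg_mul, ← neg_add, hAX, neg_zero, neg_zero]; exact PosSemidef.zero

end Lyapunov

/-! ### Stability and uniqueness for Riccati equations -/

section Riccati

variable {σ ι : Type*} [Fintype σ] [Fintype ι] [DecidableEq ι]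

/-- The closed loop of a positive definite Riccati solution `P` is Lyapunov stable, certified
by `P`. -/
lemma IsCARESolution.closedLoop_posDef {A : Matrix σ σ ℝ} {B : Matrix σ ι ℝ} {Q : Matrix σ σ ℝ}
    {R : Matrix ι ι ℝ} {P : Matrix σ σ ℝ} (h : IsCARESolution A B Q R P) (hQ : Q.PosDef)
    (hR : R.PosDef) :
    (-((A - B * R⁻¹ * Bᵀ * P)ᵀ * P + P * (A - B * R⁻¹ * Bᵀ * P))).PosDef := by
  have hPT := isHermitian_iff_transpose_eq.1 h.1.isHermitian
  have hRT : R⁻¹ᵀ = R⁻¹ := isHermitian_iff_transpose_eq.1 hR.inv.isHermitian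
  have hS : ((Bᵀ * P)ᵀ * R⁻¹ * (Bᵀ * P)).PosSemidef := by
    have := hR.inv.posSemidef.conjTranspose_mul_mul_same (Bᵀ * P)
    rwa [conjTranspose_eq_transpose_of_trivial] at this
  have := hQ.add_posSemidef hS
  convert this using 1
  have h2 := eq_neg_of_add_eq_zero_right h.2
  rw [h2]
  simp only [transpose_sub, transpose_mul, transpose_transpose, hPT, hRT, Matrix.mul_sub,
    Matrix.sub_mul, Matrix.mul_assoc]
  abel

/-- A Riccati equation with positive definite `Q` has at most one positive definite solution. -/
lemma IsCARESolution.unique {A : Matrix σ σ ℝ} {B : Matrix σ ι ℝ} {Q : Matrix σ σ ℝ}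
    {R : Matrix ι ι ℝ} {P₁ P₂ : Matrix σ σ ℝ} (hQ : Q.PosDef) (hR : R.PosDef)
    (h₁ : IsCARESolution A B Q R P₁) (h₂ : IsCARESolution A B Q R P₂) : P₁ = P₂ := by
  -- With `Y = P - P'`, subtracting the equations shows that the Lyapunov operator of the closed
  -- loop of `P` sends `Y` to `-(Y * B * R⁻¹ * Bᵀ * Y)`, so comparison gives `Y ≥ 0`. Exchanging `P`
  -- and `P'` gives equality.
  have key : ∀ P P' : Matrix σ σ ℝ, IsCARESolution A B Q R P → IsCARESolution A B Q R P' →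
      (P - P').PosSemidef := by
    intro P P' h h'
    have hPT := isHermitian_iff_transpose_eq.1 h.1.isHermitian
    have hPT' := isHermitian_iff_transpose_eq.1 h'.1.isHermitian
    have hRT : R⁻¹ᵀ = R⁻¹ := isHermitian_iff_transpose_eq.1 hR.inv.isHermitian
    have hX : (P - P').IsHermitian := h.1.isHermitian.sub h'.1.isHermitian
    refine posSemidef_of_lyapunov h.1 (h.closedLoop_posDef hQ hR) hX ?_
    have hS : ((Bᵀ * (P - P'))ᵀ * R⁻¹ * (Bᵀ * (P - P'))).PosSemidef := by
      have := hR.inv.posSemidef.conjTranspose_mul_mul_same (Bᵀ * (P - P'))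
      rwa [conjTranspose_eq_transpose_of_trivial] at this
    convert hS using 1
    have e := h.2.trans h'.2.symm
    rw [← sub_eq_zero] at e ⊢
    rw [← neg_eq_zero, ← e]
    simp only [transpose_sub, transpose_mul, transpose_transpose, hPT, hPT', hRT,
      Matrix.mul_sub, Matrix.sub_mul, Matrix.mul_assoc]
    abel
  exact sub_eq_zero.1 (eq_zero_of_posSemidef_of_neg (key _ _ h₁ h₂)
    (by rw [neg_sub]; exact key _ _ h₂ h₁))

end Riccati

/-! ### Finite-dimensional tools: perturbed linear equations and equivalence of norms -/

/-- Solvability of a Lipschitz perturbation of an injective linear equation, with a linear bound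
on the solution. -/
lemma exists_solution_of_injective_add_lipschitz {E : Type*} [NormedAddCommGroup E]
    [NormedSpace ℝ E] [FiniteDimensional ℝ E] (L : E →ₗ[ℝ] E) (hL : Function.Injective L) :
    ∃ κ > 0, ∀ (g : E → E) (q : E), g 0 = 0 →
      (∀ x y : E, ‖x‖ ≤ 2 / κ * ‖q‖ → ‖y‖ ≤ 2 / κ * ‖q‖ → ‖g x - g y‖ ≤ κ / 2 * ‖x - y‖) →
      ∃ x, ‖x‖ ≤ 2 / κ * ‖q‖ ∧ L x + g x = q := by
  have : CompleteSpace E := FiniteDimensional.complete ℝ E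
  let L' : E →L[ℝ] E := LinearMap.toContinuousLinearMap L
  have hsurj : L'.range = ⊤ := LinearMap.range_eq_top.2 (LinearMap.surjective_of_injective hL)
  obtain ⟨r, hr⟩ := ContinuousLinearMap.exists_nonlinearRightInverse_of_surjective L' hsurj
  have hκ : (0 : ℝ) < (r.nnnorm : ℝ)⁻¹ := inv_pos.2 hr
  refine ⟨(r.nnnorm : ℝ)⁻¹, hκ, fun g q hg hlip => ?_⟩
  set κ : ℝ := (r.nnnorm : ℝ)⁻¹ with hκdef
  have happ : ApproximatesLinearOn (fun x => L x + g x) L'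
      (Metric.closedBall 0 (2 / κ * ‖q‖)) (κ / 2).toNNReal := by
    intro x hx y hy
    rw [Real.coe_toNNReal _ (by positivity)]
    rw [mem_closedBall_zero_iff] at hx hy
    convert hlip x y hx hy using 2
    simp only [L', LinearMap.coe_toContinuousLinearMap', map_sub]
    abel
  -- The perturbation uses up half of `κ`; the other half makes the image of the ball of radius `2 /
  -- κ * ‖q‖` cover the ball of radius `‖q‖`.
  have hs := happ.surjOn_closedBall_of_nonlinearRightInverse r (ε := 2 / κ * ‖q‖) (b := 0)
    (by positivity) subset_rfl
  obtain ⟨x, hx, hxq⟩ := hs (a := q) (by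
    rw [Real.coe_toNNReal _ (by positivity), hg, map_zero, add_zero, mem_closedBall_zero_iff,
      ← hκdef]
    apply le_of_eq
    field_simp
    ring)
  exact ⟨x, mem_closedBall_zero_iff.1 hx, hxq⟩

/-- On a finite-dimensional space every seminorm is bounded by a multiple of every norm. -/
lemma seminorm_le_mul_of_definite {E : Type*} [AddCommGroup E] [Module ℝ E]
    [FiniteDimensional ℝ E] (p q : Seminorm ℝ E) (hq : ∀ x, q x = 0 → x = 0) :
    ∃ C > 0, ∀ x, p x ≤ C * q x := by
  -- Taking `q` itself as the norm bounds each coordinate functional by a multiple of `q`.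
  let _ : Norm E := ⟨q⟩
  let core : NormedSpace.Core ℝ E :=
    { norm_nonneg := apply_nonneg q
      norm_smul := map_smul_eq_mul q
      norm_triangle := map_add_le_add q
      norm_eq_zero_iff := fun x => ⟨hq x, fun h => by rw [h]; exact map_zero q⟩ }
  let : NormedAddCommGroup E := NormedAddCommGroup.ofCore core
  let : NormedSpace ℝ E := NormedSpace.ofCore core
  let b := Module.finBasis ℝ E
  refine ⟨∑ i, ‖LinearMap.toContinuousLinearMap (b.coord i)‖ * p (b i) + 1, ?_, fun x => ?_⟩
  · have : 0 ≤ ∑ i, ‖LinearMap.toContinuousLinearMap (b.coord i)‖ * p (b i) :=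
      Finset.sum_nonneg fun i _ => mul_nonneg (norm_nonneg _) (apply_nonneg _ _)
    linarith
  have hqx : 0 ≤ q x := apply_nonneg q x
  calc p x = p (∑ i, b.repr x i • b i) := by rw [b.sum_repr]
    _ ≤ ∑ i, p (b.repr x i • b i) := by
        refine Finset.le_sum_of_subadditive p (map_zero p).le (map_add_le_add p) _ _
    _ ≤ ∑ i, ‖LinearMap.toContinuousLinearMap (b.coord i)‖ * p (b i) * q x := by
        refine Finset.sum_le_sum fun i _ => ?_
        rw [map_smul_eq_mul, mul_right_comm]
        refine mul_le_mul_of_nonneg_right ?_ (apply_nonneg _ _)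
        exact (LinearMap.toContinuousLinearMap (b.coord i)).le_opNorm x
    _ = (∑ i, ‖LinearMap.toContinuousLinearMap (b.coord i)‖ * p (b i)) * q x := by
        rw [Finset.sum_mul]
    _ ≤ _ := by nlinarith

/-! ### Perturbation of positive definiteness and of Riccati equations -/

section Perturbation

attribute [local instance] Matrix.frobeniusNormedAddCommGroup Matrix.frobeniusNormedSpace

variable {σ : Type*}

/-- The smallest `t` with `X - t • P` singular is an eigenvalue of `P⁻¹ * X`, so `|t| < 1`, and `P +
X = (X - t • P) + (1 + t) • P`. -/
lemma posDef_add_of_norm_lt [Fintype σ] [DecidableEq σ] {P X : Matrix σ σ ℝ} (hP : P.PosDef)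
    (hX : X.IsHermitian) (h : ‖P⁻¹‖ * ‖X‖ < 1) : (P + X).PosDef := by
  cases isEmpty_or_nonempty σ
  · rwa [Subsingleton.elim (P + X) P]
  obtain ⟨t, hpsd, v, hv, hker⟩ := exists_posSemidef_sub_smul_singular hP hX
  -- The eigenvector becomes a one-column matrix so that submultiplicativity of the Frobenius norm
  -- applies.
  have hcol : P⁻¹ * X * replicateCol Unit v = t • replicateCol Unit v := by
    have h1 : X *ᵥ v = t • P *ᵥ v := by
      rw [sub_mulVec, smul_mulVec] at hker
      exact sub_eq_zero.1 hker
    have h2 : (P⁻¹ * X) *ᵥ v = t • v := by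
      rw [← mulVec_mulVec, h1, mulVec_smul, mulVec_mulVec,
        nonsing_inv_mul _ ((isUnit_iff_isUnit_det _).1 hP.isUnit), one_mulVec]
    rw [← replicateCol_mulVec, h2, replicateCol_smul]
  have hcol0 : 0 < ‖replicateCol Unit v‖ := by
    rw [norm_pos_iff]
    intro h0
    exact hv (funext fun i => congrFun (congrFun h0 i) ())
  have ht : |t| < 1 := by
    have h3 : ‖P⁻¹ * X * replicateCol Unit v‖ ≤ ‖P⁻¹‖ * ‖X‖ * ‖replicateCol Unit v‖ :=
      (frobenius_norm_mul _ _).trans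
        (mul_le_mul_of_nonneg_right (frobenius_norm_mul _ _) (norm_nonneg _))
    rw [hcol, norm_smul, Real.norm_eq_abs] at h3
    exact (le_of_mul_le_mul_right h3 hcol0).trans_lt h
  have hsum : P + X = (X - t • P) + (1 + t) • P := by
    rw [add_smul, one_smul]
    abel
  rw [hsum]
  exact PosDef.posSemidef_add hpsd (hP.smul (by linarith [neg_abs_le t]))

variable (σ) in
/-- The space of symmetric matrices. -/
def symmetricMatrices : Submodule ℝ (Matrix σ σ ℝ) where
  carrier := {X | Xᵀ = X}
  add_mem' {X Y} hX hY := by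
    change (X + Y)ᵀ = X + Y
    rw [transpose_add, hX, hY]
  zero_mem' := transpose_zero
  smul_mem' c X hX := by
    change (c • X)ᵀ = c • X
    rw [transpose_smul, hX]

lemma mem_symmetricMatrices {X : Matrix σ σ ℝ} : X ∈ symmetricMatrices σ ↔ Xᵀ = X := Iff.rfl

variable [Fintype σ]

/-- The Lyapunov operator `X ↦ Aᵀ X + X A` on symmetric matrices. -/
def lyapunovMap (A : Matrix σ σ ℝ) : symmetricMatrices σ →ₗ[ℝ] symmetricMatrices σ where
  toFun X := ⟨Aᵀ * X + X * A, by
    rw [mem_symmetricMatrices, transpose_add, transpose_mul, transpose_mul, transpose_transpose,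
      mem_symmetricMatrices.1 X.2, add_comm]⟩
  map_add' X Y := by
    ext1
    simp only [Submodule.coe_add, Matrix.mul_add, Matrix.add_mul]
    abel
  map_smul' c X := by
    ext1
    simp only [Submodule.coe_smul, Matrix.mul_smul, Matrix.smul_mul, RingHom.id_apply, smul_add]

/-- A small perturbation of a Riccati equation that is solved by `0` and has a stable
linearization there is solvable, with a linear bound on the solution. -/
lemma exists_riccati_perturbation {A P S : Matrix σ σ ℝ} (hP : P.PosDef)
    (hA : (-(Aᵀ * P + P * A)).PosDef) (hS : Sᵀ = S) :
    ∃ K > 0, ∀ D q : Matrix σ σ ℝ, qᵀ = q → K * ‖D‖ ≤ 1 → K * ‖q‖ ≤ 1 →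
      ∃ X : Matrix σ σ ℝ, Xᵀ = X ∧ ‖X‖ ≤ K * ‖q‖ ∧
        (A + D)ᵀ * X + X * (A + D) - X * S * X + q = 0 := by
  have hinj : Function.Injective (lyapunovMap A) := by
    rw [injective_iff_map_eq_zero]
    intro X hX
    ext1
    exact eq_zero_of_lyapunov_eq_zero hP hA (isHermitian_iff_transpose_eq.2 X.2)
      (congrArg Subtype.val hX)
  obtain ⟨κ, hκ, hsolve⟩ := exists_solution_of_injective_add_lipschitz (lyapunovMap A) hinj
  have hSn := norm_nonneg S
  -- The first summand bounds the Lipschitz constant of the terms with `D` by `κ / 4`, the second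
  -- does the same for the quadratic term on the ball of radius `2 / κ * ‖q‖`; together they use the
  -- allowed `κ / 2`.
  refine ⟨8 / κ + 16 * ‖S‖ / κ ^ 2, by positivity, fun D q hq hDK hqK => ?_⟩
  have hDn := norm_nonneg D
  have hqn := norm_nonneg q
  have hD : 8 * ‖D‖ ≤ κ := by
    have h1 : 8 / κ * ‖D‖ ≤ 1 := by
      refine le_trans (mul_le_mul_of_nonneg_right ?_ hDn) hDK
      have : 0 ≤ 16 * ‖S‖ / κ ^ 2 := by positivity
      linarith
    rwa [div_mul_eq_mul_div, div_le_one hκ] at h1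
  have hSq : 16 * ‖S‖ * ‖q‖ ≤ κ ^ 2 := by
    have h1 : 16 * ‖S‖ / κ ^ 2 * ‖q‖ ≤ 1 := by
      refine le_trans (mul_le_mul_of_nonneg_right ?_ hqn) hqK
      have : 0 ≤ 8 / κ := by positivity
      linarith
    rwa [div_mul_eq_mul_div, div_le_one (by positivity)] at h1
  let g : symmetricMatrices σ → symmetricMatrices σ := fun X =>
    ⟨Dᵀ * X + X * D - X * S * X, by
      rw [mem_symmetricMatrices]
      simp only [transpose_sub, transpose_add, transpose_mul, transpose_transpose,
        mem_symmetricMatrices.1 X.2, hS, Matrix.mul_assoc]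
      abel⟩
  let q' : symmetricMatrices σ := ⟨-q, by rw [mem_symmetricMatrices, transpose_neg, hq]⟩
  have hq' : ‖q'‖ = ‖q‖ := norm_neg q
  obtain ⟨X, hXn, hX⟩ := hsolve g q' (by ext1; simp [g]) (by
    intro x y hx hy
    rw [hq'] at hx hy
    have hxy : ((g x - g y : symmetricMatrices σ) : Matrix σ σ ℝ) =
        Dᵀ * (x - y : symmetricMatrices σ) + (x - y : symmetricMatrices σ) * D
          - (x * S * (x - y : symmetricMatrices σ) + (x - y : symmetricMatrices σ) * (S * y)) := by
      simp only [g, Submodule.coe_sub, Matrix.mul_sub, Matrix.sub_mul, Matrix.mul_assoc]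
      abel
    have hb : ‖g x - g y‖ ≤ ‖D‖ * ‖x - y‖ + ‖x - y‖ * ‖D‖
        + (‖x‖ * ‖S‖ * ‖x - y‖ + ‖x - y‖ * (‖S‖ * ‖y‖)) := by
      change ‖((g x - g y : symmetricMatrices σ) : Matrix σ σ ℝ)‖ ≤ _
      rw [hxy]
      refine (norm_sub_le _ _).trans (add_le_add ((norm_add_le _ _).trans (add_le_add ?_ ?_))
        ((norm_add_le _ _).trans (add_le_add ?_ ?_)))
      · exact (frobenius_norm_mul _ _).trans_eq (by rw [frobenius_norm_transpose]; rfl)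
      · exact frobenius_norm_mul _ _
      · exact (frobenius_norm_mul _ _).trans
          (mul_le_mul_of_nonneg_right (frobenius_norm_mul _ _) (norm_nonneg _))
      · exact (frobenius_norm_mul _ _).trans
          (mul_le_mul_of_nonneg_left (frobenius_norm_mul _ _) (norm_nonneg _))
    have hSx : ∀ z : symmetricMatrices σ, ‖z‖ ≤ 2 / κ * ‖q‖ → ‖S‖ * ‖z‖ ≤ κ / 8 := by
      intro z hz
      calc ‖S‖ * ‖z‖ ≤ ‖S‖ * (2 / κ * ‖q‖) := mul_le_mul_of_nonneg_left hz hSn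
        _ = 16 * ‖S‖ * ‖q‖ / κ / 8 := by ring
        _ ≤ κ ^ 2 / κ / 8 := by gcongr
        _ = κ / 8 := by field_simp
    refine hb.trans ?_
    have h1 := mul_le_mul_of_nonneg_right (hSx x hx) (norm_nonneg (x - y))
    have h2 := mul_le_mul_of_nonneg_right (hSx y hy) (norm_nonneg (x - y))
    have h3 := mul_le_mul_of_nonneg_right hD (norm_nonneg (x - y))
    nlinarith)
  refine ⟨X, X.2, ?_, ?_⟩
  · refine hXn.trans ?_
    rw [hq']
    refine mul_le_mul_of_nonneg_right ?_ hqn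
    have h1 : 2 / κ ≤ 8 / κ := by gcongr; norm_num
    have h2 : 0 ≤ 16 * ‖S‖ / κ ^ 2 := by positivity
    linarith
  · have h : Aᵀ * (X : Matrix σ σ ℝ) + X * A + (Dᵀ * X + X * D - X * S * X) = -q :=
      congrArg Subtype.val hX
    rw [← sub_eq_zero] at h
    rw [← h]
    simp only [transpose_add, Matrix.add_mul, Matrix.mul_add]
    abel

end Perturbation

/-! ### Block projections and block diagonal weights -/

section Blocks

variable {n : ℕ} (d : Fin n → ℕ) (i : Fin n)

lemma blockCol_mul_transpose :
    blockCol d i * (blockCol d i)ᵀ = diagonal fun p : Ctrl d => if p.1 = i then (1 : ℝ) else 0 := by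
  ext ⟨j, a⟩ q
  rw [mul_apply, diagonal_apply]
  simp only [blockCol, transpose_apply, of_apply]
  by_cases hj : j = i
  · subst hj
    rw [Finset.sum_eq_single a]
    · simp [eq_comm]
    · intro b _ hb
      rw [if_neg, zero_mul]
      intro h
      simp only [Sigma.mk.injEq, heq_eq_eq, true_and] at h
      exact hb h.symm
    · simp
  · rw [Finset.sum_eq_zero]
    · simp [hj]
    · intro b _
      rw [if_neg, zero_mul]
      intro h
      exact hj (congrArg Sigma.fst h)

lemma transpose_blockCol_mul_self : (blockCol d i)ᵀ * blockCol d i = 1 := by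
  ext a b
  rw [mul_apply, one_apply]
  simp only [blockCol, transpose_apply, of_apply]
  rw [Finset.sum_eq_single ⟨i, a⟩]
  · simp
  · intro p _ hp
    rw [if_neg hp, zero_mul]
  · simp

lemma transpose_blockCol_apply {σ : Type*} (F : Matrix (Ctrl d) σ ℝ) (a : Fin (d i)) (s : σ) :
    ((blockCol d i)ᵀ * F) a s = F ⟨i, a⟩ s := by
  rw [mul_apply]
  simp only [blockCol, transpose_apply, of_apply]
  rw [Finset.sum_eq_single ⟨i, a⟩]
  · simp
  · intro p _ hp
    rw [if_neg hp, zero_mul]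
  · simp

lemma blockCol_mul_transpose_add_compl : blockCol d i * (blockCol d i)ᵀ + compl d i = 1 := by
  rw [compl, add_sub_cancel]

lemma compl_transpose : (compl d i)ᵀ = compl d i := by
  rw [compl, transpose_sub, transpose_one, transpose_mul, transpose_transpose]

lemma transpose_blockCol_mul_compl : (blockCol d i)ᵀ * compl d i = 0 := by
  rw [compl, Matrix.mul_sub, Matrix.mul_one, ← Matrix.mul_assoc, transpose_blockCol_mul_self,
    Matrix.one_mul, sub_self]

lemma compl_mul_blockCol : compl d i * blockCol d i = 0 := by
  rw [compl, Matrix.sub_mul, Matrix.one_mul, Matrix.mul_assoc, transpose_blockCol_mul_self,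
    Matrix.mul_one, sub_self]

lemma compl_mul_self : compl d i * compl d i = compl d i := by
  nth_rewrite 1 [compl]
  rw [Matrix.sub_mul, Matrix.one_mul, Matrix.mul_assoc, transpose_blockCol_mul_compl,
    Matrix.mul_zero, sub_zero]

lemma compl_apply_of_ne {σ : Type*} (F : Matrix (Ctrl d) σ ℝ) (p : Ctrl d) (hp : p.1 ≠ i) (s : σ) :
    (compl d i * F) p s = F p s := by
  rw [compl, blockCol_mul_transpose, Matrix.sub_mul, Matrix.one_mul, Matrix.sub_apply, diagonal_mul,
    if_neg hp, zero_mul, sub_zero]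

variable {d} {R : Matrix (Ctrl d) (Ctrl d) ℝ}

lemma compl_comm_of_blockDiagonal (hRblock : ∀ p q : Ctrl d, p.1 ≠ q.1 → R p q = 0) :
    compl d i * R = R * compl d i := by
  rw [compl, blockCol_mul_transpose, Matrix.sub_mul, Matrix.mul_sub, Matrix.one_mul,
    Matrix.mul_one]
  congr 1
  ext p q
  rw [diagonal_mul, mul_diagonal]
  by_cases h : p.1 = q.1
  · rw [h, mul_comm]
  · rw [hRblock p q h, mul_zero, zero_mul]

lemma subR_posDef (hR : R.PosDef) : (subR R i).PosDef := by
  have h := hR.conjTranspose_mul_mul_same (B := blockCol d i) (by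
    intro v w h
    have := congrArg (fun u => (blockCol d i)ᵀ *ᵥ u) h
    simpa [mulVec_mulVec, transpose_blockCol_mul_self] using this)
  rwa [conjTranspose_eq_transpose_of_trivial] at h

/-- Block diagonality removes the coupling of block `i` to the others; through this identity only
the `i`-th block of the optimal feedback enters the subproblem. -/
lemma subR_mul_transpose_blockCol (hRblock : ∀ p q : Ctrl d, p.1 ≠ q.1 → R p q = 0) :
    subR R i * (blockCol d i)ᵀ = (blockCol d i)ᵀ * R := by
  have h : blockCol d i * (blockCol d i)ᵀ = 1 - compl d i :=
    eq_sub_of_add_eq (blockCol_mul_transpose_add_compl d i)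
  rw [subR, Matrix.mul_assoc, h, Matrix.mul_assoc, Matrix.mul_sub, Matrix.mul_one,
    ← compl_comm_of_blockDiagonal i hRblock, Matrix.mul_sub, ← Matrix.mul_assoc _ (compl d i),
    transpose_blockCol_mul_compl, Matrix.zero_mul, sub_zero]

lemma subQ_posDef {m : ℕ} {Q : Matrix (Fin m) (Fin m) ℝ} (hQ : Q.PosDef) (hR : R.PosDef)
    (F : Matrix (Ctrl d) (Fin m) ℝ) : (subQ Q R i F).PosDef := by
  refine hQ.add_posSemidef ?_
  have h := hR.posSemidef.conjTranspose_mul_mul_same (compl d i * F)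
  rwa [conjTranspose_eq_transpose_of_trivial, transpose_mul, compl_transpose,
    ← Matrix.mul_assoc] at h

end Blocks

/-! ### One update near the optimum -/

section Update

variable {m n : ℕ} {d : Fin n → ℕ} {A : Matrix (Fin m) (Fin m) ℝ} {B : Matrix (Fin m) (Ctrl d) ℝ}
  {Q : Matrix (Fin m) (Fin m) ℝ} {R : Matrix (Ctrl d) (Ctrl d) ℝ}

lemma IsUpdate.unique {i : Fin n} {F F₁ F₂ : Matrix (Ctrl d) (Fin m) ℝ} (hQ : Q.PosDef)
    (hR : R.PosDef) (h₁ : IsUpdate A B Q R i F F₁) (h₂ : IsUpdate A B Q R i F F₂) : F₁ = F₂ := by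
  obtain ⟨P₁, hP₁, hb₁, hc₁⟩ := h₁
  obtain ⟨P₂, hP₂, hb₂, hc₂⟩ := h₂
  have hP := IsCARESolution.unique (subQ_posDef i hQ hR F) (subR_posDef i hR) hP₁ hP₂
  subst hP
  rw [← Matrix.one_mul F₁, ← Matrix.one_mul F₂, ← blockCol_mul_transpose_add_compl d i,
    Matrix.add_mul, Matrix.add_mul, Matrix.mul_assoc, Matrix.mul_assoc, hb₁, hb₂, hc₁, hc₂]

/-- The blocks that are not updated stay the same. -/
lemma IsUpdate.transpose_blockCol_mul_of_ne {i j : Fin n} {F F' : Matrix (Ctrl d) (Fin m) ℝ}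
    (h : IsUpdate A B Q R i F F') (hj : j ≠ i) :
    (blockCol d j)ᵀ * F' = (blockCol d j)ᵀ * F := by
  obtain ⟨P, -, -, hc⟩ := h
  ext a s
  rw [transpose_blockCol_apply, transpose_blockCol_apply,
    ← compl_apply_of_ne d i F' ⟨j, a⟩ hj, ← compl_apply_of_ne d i F ⟨j, a⟩ hj, hc]

variable {P : Matrix (Fin m) (Fin m) ℝ}

lemma mul_feedback (hR : R.PosDef) : R * feedback B R P = -(Bᵀ * P) := by
  rw [feedback, Matrix.mul_neg, Matrix.mul_assoc, ← Matrix.mul_assoc,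
    mul_nonsing_inv _ ((isUnit_iff_isUnit_det _).1 hR.isUnit), Matrix.one_mul]

lemma subB_transpose_mul_add (i : Fin n) (hR : R.PosDef)
    (hRblock : ∀ p q : Ctrl d, p.1 ≠ q.1 → R p q = 0) (X : Matrix (Fin m) (Fin m) ℝ) :
    (subB B i)ᵀ * (P + X) =
      (subB B i)ᵀ * X - subR R i * ((blockCol d i)ᵀ * feedback B R P) := by
  rw [← Matrix.mul_assoc, subR_mul_transpose_blockCol i hRblock, Matrix.mul_assoc _ R,
    mul_feedback hR, subB, transpose_mul, Matrix.mul_add, Matrix.mul_assoc _ Bᵀ P, Matrix.mul_neg]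
  abel

/-- The feedback of the subproblem at `P + X` deviates from the block of the optimal feedback
only through `X`. -/
lemma feedback_sub_add (i : Fin n) (hR : R.PosDef)
    (hRblock : ∀ p q : Ctrl d, p.1 ≠ q.1 → R p q = 0) (X : Matrix (Fin m) (Fin m) ℝ) :
    feedback (subB B i) (subR R i) (P + X) - (blockCol d i)ᵀ * feedback B R P =
      -((subR R i)⁻¹ * (subB B i)ᵀ * X) := by
  rw [feedback, Matrix.mul_assoc, subB_transpose_mul_add i hR hRblock, Matrix.mul_sub,
    ← Matrix.mul_assoc _ (subR R i),
    nonsing_inv_mul _ ((isUnit_iff_isUnit_det _).1 (subR_posDef i hR).isUnit), Matrix.one_mul,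
    ← Matrix.mul_assoc]
  abel

/-- The Riccati expression of the subproblem, centred at the optimal solution: the deviation `D`
of the feedback enters the inhomogeneity only quadratically. -/
lemma subproblem_riccati_eq (i : Fin n) (hR : R.PosDef)
    (hRblock : ∀ p q : Ctrl d, p.1 ≠ q.1 → R p q = 0) (hP : IsCARESolution A B Q R P)
    {X : Matrix (Fin m) (Fin m) ℝ} (hX : Xᵀ = X) (D : Matrix (Ctrl d) (Fin m) ℝ) :
    (subA A B i (feedback B R P + D))ᵀ * (P + X) + (P + X) * subA A B i (feedback B R P + D)
        - (P + X) * subB B i * (subR R i)⁻¹ * (subB B i)ᵀ * (P + X)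
        + subQ Q R i (feedback B R P + D) =
      (A + B * feedback B R P + B * compl d i * D)ᵀ * X
        + X * (A + B * feedback B R P + B * compl d i * D)
        - X * (subB B i * (subR R i)⁻¹ * (subB B i)ᵀ) * X
        + Dᵀ * (compl d i * R) * D := by
  have hPT := isHermitian_iff_transpose_eq.1 hP.1.isHermitian
  have hRT := isHermitian_iff_transpose_eq.1 hR.isHermitian
  have hRi := subR_posDef i hR
  have hRiT := isHermitian_iff_transpose_eq.1 hRi.isHermitian
  have hunit := (isUnit_iff_isUnit_det _).1 hRi.isUnit
  have hG := mul_feedback (B := B) (P := P) hR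
  have hW := subB_transpose_mul_add (B := B) (P := P) i hR hRblock X
  have hcare : Q = (feedback B R P)ᵀ * (R * feedback B R P) - Aᵀ * P - P * A := by
    have h := eq_neg_of_add_eq_zero_right hP.2
    rw [h, hG, feedback, transpose_neg, transpose_mul, transpose_mul, transpose_transpose, hPT,
      isHermitian_iff_transpose_eq.1 hR.inv.isHermitian]
    simp only [Matrix.mul_assoc, Matrix.mul_neg, Matrix.neg_mul, neg_neg]
    abel
  set G := feedback B R P with hGdef
  have hGT : P * B = -(Gᵀ * R) := by
    have := congrArg transpose hG
    rw [transpose_mul, transpose_neg, transpose_mul, transpose_transpose, hRT, hPT] at this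
    rw [this, neg_neg]
  have hC := compl_comm_of_blockDiagonal i hRblock
  have hCC := compl_mul_self d i
  -- Substituting `hW` on both sides cancels `(subR R i)⁻¹` in every term except the one quadratic
  -- in `X`.
  have hquad : (P + X) * subB B i * (subR R i)⁻¹ * (subB B i)ᵀ * (P + X) =
      X * (subB B i * (subR R i)⁻¹ * (subB B i)ᵀ) * X - X * (B * (G - compl d i * G))
        - (G - compl d i * G)ᵀ * (Bᵀ * X) + Gᵀ * ((R - compl d i * R) * G) := by
    have hW' : (P + X) * subB B i =
        X * subB B i - Gᵀ * (blockCol d i * subR R i) := by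
      have := congrArg transpose hW
      simp only [transpose_mul, transpose_sub, transpose_add, transpose_transpose, hPT, hX,
        hRiT] at this
      rw [this, Matrix.mul_assoc]
    have hJ : blockCol d i * ((blockCol d i)ᵀ * G) = G - compl d i * G := by
      rw [← Matrix.mul_assoc, eq_sub_of_add_eq (blockCol_mul_transpose_add_compl d i),
        Matrix.sub_mul, Matrix.one_mul]
    have hJR : blockCol d i * (subR R i * ((blockCol d i)ᵀ * G)) = (R - compl d i * R) * G := by
      rw [← Matrix.mul_assoc (subR R i), subR_mul_transpose_blockCol i hRblock,
        ← Matrix.mul_assoc, ← Matrix.mul_assoc,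
        eq_sub_of_add_eq (blockCol_mul_transpose_add_compl d i), Matrix.sub_mul (1 : Matrix _ _ ℝ),
        Matrix.one_mul]
    have hJT : ∀ Y : Matrix (Ctrl d) (Fin m) ℝ,
        Gᵀ * (blockCol d i * ((blockCol d i)ᵀ * Y)) = (G - compl d i * G)ᵀ * Y := by
      intro Y
      rw [← hJ, transpose_mul, transpose_mul, transpose_transpose]
      simp only [Matrix.mul_assoc]
    rw [Matrix.mul_assoc _ (subB B i)ᵀ, hW, hW', Matrix.sub_mul, Matrix.sub_mul, Matrix.mul_sub,
      Matrix.mul_sub]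
    have e1 : X * subB B i * (subR R i)⁻¹ * (subR R i * ((blockCol d i)ᵀ * G)) =
        X * (B * (G - compl d i * G)) := by
      rw [Matrix.mul_assoc _ (subR R i)⁻¹, ← Matrix.mul_assoc (subR R i)⁻¹,
        nonsing_inv_mul _ hunit, Matrix.one_mul, subB, ← hJ]
      simp only [Matrix.mul_assoc]
    have e2 : Gᵀ * (blockCol d i * subR R i) * (subR R i)⁻¹ * ((subB B i)ᵀ * X) =
        (G - compl d i * G)ᵀ * (Bᵀ * X) := by
      rw [← hJT, ← Matrix.mul_assoc Gᵀ, Matrix.mul_assoc _ (subR R i), mul_nonsing_inv _ hunit,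
        Matrix.mul_one, subB, transpose_mul]
      simp only [Matrix.mul_assoc]
    have e3 : Gᵀ * (blockCol d i * subR R i) * (subR R i)⁻¹
        * (subR R i * ((blockCol d i)ᵀ * G)) = Gᵀ * ((R - compl d i * R) * G) := by
      rw [← hJR, ← Matrix.mul_assoc Gᵀ, Matrix.mul_assoc _ (subR R i), mul_nonsing_inv _ hunit,
        Matrix.mul_one]
      simp only [Matrix.mul_assoc]
    rw [e1, e2, e3]
    simp only [Matrix.mul_assoc]
    abel
  rw [hquad, subA, subQ, hcare]
  -- Once every `P * B` is `-(Gᵀ * R)`, the terms linear in `D` from `subA` cancel those from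
  -- `subQ`.
  have hPB : ∀ Y : Matrix (Ctrl d) (Fin m) ℝ, P * (B * Y) = -(Gᵀ * (R * Y)) := by
    intro Y
    rw [← Matrix.mul_assoc, hGT, Matrix.neg_mul, Matrix.mul_assoc]
  have hBP : Bᵀ * P = -(R * G) := by rw [hG, neg_neg]
  have hCT := compl_transpose d i
  have hCR : ∀ Y : Matrix (Ctrl d) (Fin m) ℝ, compl d i * (R * Y) = R * (compl d i * Y) := by
    intro Y
    rw [← Matrix.mul_assoc, hC, Matrix.mul_assoc]
  have hCCY : ∀ Y : Matrix (Ctrl d) (Fin m) ℝ, compl d i * (compl d i * Y) = compl d i * Y := by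
    intro Y
    rw [← Matrix.mul_assoc, hCC]
  simp only [transpose_add, transpose_sub, transpose_mul, hCT, Matrix.mul_add, Matrix.add_mul,
    Matrix.mul_sub, Matrix.sub_mul, Matrix.mul_assoc, hPB, hBP, hCR, hCCY, Matrix.mul_neg]
  abel

attribute [local instance] Matrix.frobeniusNormedAddCommGroup Matrix.frobeniusNormedSpace

/-- Near the optimal feedback, the update of a subsystem exists and its error is quadratically
small in the updated block. -/
lemma exists_update_near_optimal (i : Fin n) (hQ : Q.PosDef) (hR : R.PosDef)
    (hRblock : ∀ p q : Ctrl d, p.1 ≠ q.1 → R p q = 0) (hP : IsCARESolution A B Q R P) :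
    ∃ K > 0, ∀ F : Matrix (Ctrl d) (Fin m) ℝ, K * ‖F - feedback B R P‖ ≤ 1 →
      ∃ F', IsUpdate A B Q R i F F' ∧
        ‖(blockCol d i)ᵀ * (F' - feedback B R P)‖ ≤ K * ‖F - feedback B R P‖ ^ 2 := by
  have hRi := subR_posDef i hR
  have hstable : (-((A + B * feedback B R P)ᵀ * P + P * (A + B * feedback B R P))).PosDef := by
    have h : A + B * feedback B R P = A - B * R⁻¹ * Bᵀ * P := by
      rw [feedback, Matrix.mul_neg, ← sub_eq_add_neg]
      simp only [Matrix.mul_assoc]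
    rw [h]
    exact hP.closedLoop_posDef hQ hR
  have hS : (subB B i * (subR R i)⁻¹ * (subB B i)ᵀ)ᵀ = subB B i * (subR R i)⁻¹ * (subB B i)ᵀ := by
    rw [transpose_mul, transpose_mul, transpose_transpose,
      isHermitian_iff_transpose_eq.1 hRi.inv.isHermitian, Matrix.mul_assoc]
  obtain ⟨K, hK, hsolve⟩ := exists_riccati_perturbation hP.1 hstable hS
  set G := feedback B R P with hG
  set a := ‖B * compl d i‖
  set b := ‖compl d i * R‖
  set c := ‖(subR R i)⁻¹ * (subB B i)ᵀ‖
  have ha : 0 ≤ a := norm_nonneg _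
  have hb : 0 ≤ b := norm_nonneg _
  have hc : 0 ≤ c := norm_nonneg _
  have hp : 0 ≤ ‖P⁻¹‖ := norm_nonneg _
  have hKa : 0 ≤ K * a := by positivity
  have hKb : 0 ≤ K * b := by positivity
  have hKc : 0 ≤ c * (K * b) := by positivity
  have hKp : 0 ≤ 2 * ‖P⁻¹‖ * (K * b) := by positivity
  -- The summands serve, in order: `‖D‖ ≤ 1`; smallness of the perturbation of the closed loop;
  -- smallness of the inhomogeneity; `‖P⁻¹‖ * ‖X‖ ≤ 1 / 2`, for positivity of `P + X`; the final
  -- block estimate.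
  refine ⟨1 + K * a + K * b + 2 * ‖P⁻¹‖ * (K * b) + c * (K * b), by positivity, fun F hF => ?_⟩
  set D := F - G with hD
  have hFD : F = G + D := (add_sub_cancel G F).symm
  have he : 0 ≤ ‖D‖ := norm_nonneg D
  have hbound : ∀ x : ℝ, x ≤ 1 + K * a + K * b + 2 * ‖P⁻¹‖ * (K * b) + c * (K * b) →
      x * ‖D‖ ≤ 1 := fun x hx => (mul_le_mul_of_nonneg_right hx he).trans hF
  have he1 : ‖D‖ ≤ 1 := by simpa using hbound 1 (by linarith)
  have hee : ‖D‖ ^ 2 ≤ ‖D‖ := by nlinarith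
  have hq : ‖Dᵀ * (compl d i * R) * D‖ ≤ b * ‖D‖ ^ 2 := by
    calc _ ≤ ‖Dᵀ * (compl d i * R)‖ * ‖D‖ := frobenius_norm_mul _ _
      _ ≤ ‖Dᵀ‖ * b * ‖D‖ := mul_le_mul_of_nonneg_right (frobenius_norm_mul _ _) he
      _ = b * ‖D‖ ^ 2 := by rw [frobenius_norm_transpose]; ring
  have hKq : K * ‖Dᵀ * (compl d i * R) * D‖ ≤ K * b * ‖D‖ ^ 2 := by
    rw [mul_assoc]
    exact mul_le_mul_of_nonneg_left hq hK.le
  obtain ⟨X, hXT, hXn, hX⟩ := hsolve (B * compl d i * D) (Dᵀ * (compl d i * R) * D)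
    (by
      rw [compl_comm_of_blockDiagonal i hRblock]
      simp only [transpose_mul, transpose_transpose, compl_transpose,
        isHermitian_iff_transpose_eq.1 hR.isHermitian]
      rw [compl_comm_of_blockDiagonal i hRblock, Matrix.mul_assoc Dᵀ])
    (by
      refine le_trans (mul_le_mul_of_nonneg_left (frobenius_norm_mul _ _) hK.le) ?_
      rw [← mul_assoc]
      exact hbound (K * a) (by linarith))
    (hKq.trans ((mul_le_mul_of_nonneg_left hee hKb).trans (hbound (K * b) (by linarith))))
  have hXn' : ‖X‖ ≤ K * b * ‖D‖ ^ 2 := hXn.trans hKq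
  have hposX : (P + X).PosDef := by
    refine posDef_add_of_norm_lt hP.1 (isHermitian_iff_transpose_eq.2 hXT) ?_
    have h1 := mul_le_mul_of_nonneg_left hXn' hp
    have h2 := mul_le_mul_of_nonneg_left hee hKp
    have h3 := hbound (2 * ‖P⁻¹‖ * (K * b)) (by linarith)
    nlinarith
  have hblock : (blockCol d i)ᵀ * (compl d i * F
      + blockCol d i * feedback (subB B i) (subR R i) (P + X)) =
      feedback (subB B i) (subR R i) (P + X) := by
    rw [Matrix.mul_add, ← Matrix.mul_assoc, transpose_blockCol_mul_compl, Matrix.zero_mul,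
      zero_add, ← Matrix.mul_assoc, transpose_blockCol_mul_self, Matrix.one_mul]
  refine ⟨compl d i * F + blockCol d i * feedback (subB B i) (subR R i) (P + X),
    ⟨P + X, ⟨hposX, ?_⟩, hblock, ?_⟩, ?_⟩
  · rw [← hX, hFD]
    exact subproblem_riccati_eq i hR hRblock hP hXT D
  · rw [Matrix.mul_add, ← Matrix.mul_assoc, compl_mul_self, ← Matrix.mul_assoc,
      compl_mul_blockCol, Matrix.zero_mul, add_zero]
  · rw [Matrix.mul_sub, hblock, hG, feedback_sub_add i hR hRblock, norm_neg]
    calc _ ≤ c * ‖X‖ := frobenius_norm_mul _ _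
      _ ≤ c * (K * b * ‖D‖ ^ 2) := mul_le_mul_of_nonneg_left hXn' hc
      _ = c * (K * b) * ‖D‖ ^ 2 := by ring
      _ ≤ _ := mul_le_mul_of_nonneg_right (by linarith) (sq_nonneg _)

end Update

/-! ### Block errors along the cyclic iteration -/

section Iteration

attribute [local instance] Matrix.frobeniusNormedAddCommGroup Matrix.frobeniusNormedSpace

variable {m n : ℕ} {d : Fin n → ℕ}

variable (d m) in
/-- The block rows of a feedback matrix. -/
def blockRows :
    Matrix (Ctrl d) (Fin m) ℝ →ₗ[ℝ] ((i : Fin n) → Matrix (Fin (d i)) (Fin m) ℝ) where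
  toFun M i := (blockCol d i)ᵀ * M
  map_add' M M' := funext fun _ => Matrix.mul_add _ M M'
  map_smul' c M := funext fun _ => Matrix.mul_smul _ c M

variable (d m) in
/-- The largest Frobenius norm of a block row. -/
noncomputable def blockSeminorm : Seminorm ℝ (Matrix (Ctrl d) (Fin m) ℝ) :=
  (normSeminorm ℝ ((i : Fin n) → Matrix (Fin (d i)) (Fin m) ℝ)).comp (blockRows m d)

lemma blockSeminorm_le_iff {M : Matrix (Ctrl d) (Fin m) ℝ} {s : ℝ} (hs : 0 ≤ s) :
    blockSeminorm m d M ≤ s ↔ ∀ i, ‖(blockCol d i)ᵀ * M‖ ≤ s :=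
  pi_norm_le_iff_of_nonneg (x := blockRows m d M) hs

lemma norm_block_le (M : Matrix (Ctrl d) (Fin m) ℝ) (i : Fin n) :
    ‖(blockCol d i)ᵀ * M‖ ≤ blockSeminorm m d M :=
  (blockSeminorm_le_iff (apply_nonneg _ M)).1 le_rfl i

lemma eq_zero_of_blockSeminorm_eq_zero {M : Matrix (Ctrl d) (Fin m) ℝ}
    (hM : blockSeminorm m d M = 0) : M = 0 := by
  ext ⟨i, a⟩ s
  have h : (blockCol d i)ᵀ * M = 0 := norm_le_zero_iff.1 (hM ▸ norm_block_le M i)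
  rw [← transpose_blockCol_apply d i M a s, h]
  rfl

variable {A : Matrix (Fin m) (Fin m) ℝ} {B : Matrix (Fin m) (Ctrl d) ℝ}
  {Q : Matrix (Fin m) (Fin m) ℝ} {R : Matrix (Ctrl d) (Ctrl d) ℝ} {P : Matrix (Fin m) (Fin m) ℝ}

lemma exists_update_blockSeminorm_estimate (hQ : Q.PosDef) (hR : R.PosDef)
    (hRblock : ∀ p q : Ctrl d, p.1 ≠ q.1 → R p q = 0) (hP : IsCARESolution A B Q R P) :
    ∃ K > 0, ∀ (i : Fin n) (F : Matrix (Ctrl d) (Fin m) ℝ),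
      K * blockSeminorm m d (F - feedback B R P) ≤ 1 →
      (∃ F', IsUpdate A B Q R i F F') ∧ ∀ F', IsUpdate A B Q R i F F' →
        ‖(blockCol d i)ᵀ * (F' - feedback B R P)‖ ≤
          K * blockSeminorm m d (F - feedback B R P) ^ 2 := by
  choose K hK hupd using fun i : Fin n => exists_update_near_optimal i hQ hR hRblock hP
  obtain ⟨c, hc, hnorm⟩ := seminorm_le_mul_of_definite
    (normSeminorm ℝ (Matrix (Ctrl d) (Fin m) ℝ)) (blockSeminorm m d)
    fun M => eq_zero_of_blockSeminorm_eq_zero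
  have hpos : ∀ i, 0 ≤ K i * (c + c ^ 2) := fun i => by have := hK i; positivity
  -- The sum makes the constant uniform in `i`: `c` converts the smallness condition, `c ^ 2` the
  -- quadratic bound. The extra `1` keeps it positive when `n = 0`.
  refine ⟨∑ i, K i * (c + c ^ 2) + 1, by
    have := Finset.sum_nonneg (s := Finset.univ) fun i _ => hpos i; linarith,
    fun i F hF => ?_⟩
  have hle : K i * (c + c ^ 2) ≤ ∑ i, K i * (c + c ^ 2) + 1 :=
    (Finset.single_le_sum (fun i _ => hpos i) (Finset.mem_univ i)).trans (by linarith)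
  have hKc := mul_pos (hK i) hc
  have hKc2 := mul_pos (hK i) (pow_pos hc 2)
  set s := blockSeminorm m d (F - feedback B R P)
  have hs : 0 ≤ s := apply_nonneg _ _
  have hFs : ‖F - feedback B R P‖ ≤ c * s := hnorm _
  obtain ⟨F', hF', hest⟩ := hupd i F (by
    calc K i * ‖F - feedback B R P‖ ≤ K i * (c * s) := mul_le_mul_of_nonneg_left hFs (hK i).le
      _ = K i * c * s := by ring
      _ ≤ (∑ i, K i * (c + c ^ 2) + 1) * s := mul_le_mul_of_nonneg_right (by linarith) hs
      _ ≤ 1 := hF)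
  refine ⟨⟨F', hF'⟩, fun F'' hF'' => ?_⟩
  rw [hF''.unique hQ hR hF']
  calc _ ≤ K i * ‖F - feedback B R P‖ ^ 2 := hest
    _ ≤ K i * (c * s) ^ 2 :=
        mul_le_mul_of_nonneg_left (pow_le_pow_left₀ (norm_nonneg _) hFs 2) (hK i).le
    _ = K i * c ^ 2 * s ^ 2 := by ring
    _ ≤ _ := mul_le_mul_of_nonneg_right (by linarith) (sq_nonneg s)

/-- An update near `G` does not increase the block error if it is quadratic in the updated
block. -/
lemma IsUpdate.blockSeminorm_sub_le {i : Fin n} {F F' G : Matrix (Ctrl d) (Fin m) ℝ} {s : ℝ}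
    (h : IsUpdate A B Q R i F F') (hs : blockSeminorm m d (F - G) ≤ s)
    (hi : ‖(blockCol d i)ᵀ * (F' - G)‖ ≤ s) : blockSeminorm m d (F' - G) ≤ s := by
  refine (blockSeminorm_le_iff ((norm_nonneg _).trans hi)).2 fun l => ?_
  by_cases hl : l = i
  · exact hl ▸ hi
  · rw [Matrix.mul_sub, h.transpose_blockCol_mul_of_ne hl, ← Matrix.mul_sub]
    exact (norm_block_le _ l).trans hs

lemma exists_cyclicIndex_eq (i j : Fin n) (k : ℕ) : ∃ u < n, cyclicIndex j (k + u) = i := by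
  have hn : 0 < n := i.pos
  have hr := Nat.mod_lt ((j : ℕ) + k) hn
  -- This is `i - (j + k)` modulo `n`, arranged to avoid truncated subtraction.
  refine ⟨((i : ℕ) + (n - ((j : ℕ) + k) % n)) % n, Nat.mod_lt _ hn, ?_⟩
  ext
  rw [cyclicIndex]
  dsimp only
  have h : ((j : ℕ) + k) % n + ((i : ℕ) + (n - ((j : ℕ) + k) % n)) = i + n := by omega
  rw [← add_assoc, Nat.add_mod_mod, ← Nat.mod_add_mod, h, Nat.add_mod_right, Nat.mod_eq_of_lt i.2]

variable {G : Matrix (Ctrl d) (Fin m) ℝ} {K : ℝ} {j : Fin n}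
  {F : ℕ → Matrix (Ctrl d) (Fin m) ℝ}

/-- From an iterate near `G` on, the block errors do not increase, and every updated block has
a quadratically small error. -/
lemma IsIteration.blockSeminorm_sub_le (hK : 0 < K)
    (hest : ∀ (i : Fin n) (F F' : Matrix (Ctrl d) (Fin m) ℝ), K * blockSeminorm m d (F - G) ≤ 1 →
      IsUpdate A B Q R i F F' →
        ‖(blockCol d i)ᵀ * (F' - G)‖ ≤ K * blockSeminorm m d (F - G) ^ 2)
    (hF : IsIteration A B Q R j F) {k : ℕ} (hk : K * blockSeminorm m d (F k - G) ≤ 1) (t : ℕ) :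
    blockSeminorm m d (F (k + t) - G) ≤ blockSeminorm m d (F k - G) ∧
      ∀ u < t, ‖(blockCol d (cyclicIndex j (k + u)))ᵀ * (F (k + t) - G)‖ ≤
        K * blockSeminorm m d (F k - G) ^ 2 := by
  set s := blockSeminorm m d (F k - G)
  have hs : 0 ≤ s := apply_nonneg _ _
  have hKs : K * s ^ 2 ≤ s := by nlinarith
  induction t with
  | zero => exact ⟨le_rfl, fun u hu => absurd hu (Nat.not_lt_zero u)⟩
  | succ t ih =>
    obtain ⟨ih₁, ih₂⟩ := ih
    have hupd := hF (k + t)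
    have hnew : ‖(blockCol d (cyclicIndex j (k + t)))ᵀ * (F (k + t + 1) - G)‖ ≤ K * s ^ 2 :=
      (hest _ _ _ ((mul_le_mul_of_nonneg_left ih₁ hK.le).trans hk) hupd).trans
        (mul_le_mul_of_nonneg_left (pow_le_pow_left₀ (apply_nonneg _ _) ih₁ 2) hK.le)
    refine ⟨hupd.blockSeminorm_sub_le ih₁ (hnew.trans hKs), fun u hu => ?_⟩
    -- A block renewed now has the fresh estimate; any other block is untouched and keeps its
    -- earlier one.
    by_cases hl : cyclicIndex j (k + u) = cyclicIndex j (k + t)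
    · rw [hl]
      exact hnew
    · rw [← add_assoc, Matrix.mul_sub, hupd.transpose_blockCol_mul_of_ne hl, ← Matrix.mul_sub]
      refine ih₂ u (lt_of_le_of_ne (Nat.lt_succ_iff.1 hu) ?_)
      rintro rfl
      exact hl rfl

/-- Any `n` consecutive steps renew every block, wherever in the sweep they begin. -/
lemma IsIteration.blockSeminorm_cycle_le (hK : 0 < K)
    (hest : ∀ (i : Fin n) (F F' : Matrix (Ctrl d) (Fin m) ℝ), K * blockSeminorm m d (F - G) ≤ 1 →
      IsUpdate A B Q R i F F' →
        ‖(blockCol d i)ᵀ * (F' - G)‖ ≤ K * blockSeminorm m d (F - G) ^ 2)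
    (hF : IsIteration A B Q R j F) {k : ℕ} (hk : K * blockSeminorm m d (F k - G) ≤ 1) :
    blockSeminorm m d (F (k + n) - G) ≤ K * blockSeminorm m d (F k - G) ^ 2 := by
  refine (blockSeminorm_le_iff (by positivity)).2 fun i => ?_
  obtain ⟨u, hu, rfl⟩ := exists_cyclicIndex_eq i j k
  exact (hF.blockSeminorm_sub_le hK hest hk n).2 u hu

/-- The errors decrease to a limit `ℓ`. With the threshold `1 / 2` instead of `1`, each cycle at
least halves them, so `ℓ ≤ ℓ / 2` and `ℓ = 0`. -/
lemma IsIteration.tendsto_blockSeminorm_sub (hK : 0 < K)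
    (hest : ∀ (i : Fin n) (F F' : Matrix (Ctrl d) (Fin m) ℝ), K * blockSeminorm m d (F - G) ≤ 1 →
      IsUpdate A B Q R i F F' →
        ‖(blockCol d i)ᵀ * (F' - G)‖ ≤ K * blockSeminorm m d (F - G) ^ 2)
    (hF : IsIteration A B Q R j F) (h₀ : K * blockSeminorm m d (F 0 - G) ≤ 1 / 2) :
    Filter.Tendsto (fun k => blockSeminorm m d (F k - G)) Filter.atTop (nhds 0) := by
  set s : ℕ → ℝ := fun k => blockSeminorm m d (F k - G)
  have hs : ∀ k, 0 ≤ s k := fun k => apply_nonneg _ _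
  have hsmall : ∀ k, K * s k ≤ 1 / 2 := fun k => by
    have := (hF.blockSeminorm_sub_le hK hest (k := 0) (by linarith) k).1
    rw [zero_add] at this
    exact (mul_le_mul_of_nonneg_left this hK.le).trans h₀
  have hanti : Antitone s := antitone_nat_of_succ_le fun k =>
    (hF.blockSeminorm_sub_le hK hest (by linarith [hsmall k]) 1).1
  have hbdd : BddBelow (Set.range s) := ⟨0, by rintro _ ⟨k, rfl⟩; exact hs k⟩
  have hlim := tendsto_atTop_ciInf hanti hbdd
  have hhalf : ∀ k, s (k + n) ≤ 1 / 2 * s k := fun k => by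
    have h := hF.blockSeminorm_cycle_le hK hest (k := k) (by linarith [hsmall k])
    calc s (k + n) ≤ K * s k ^ 2 := h
      _ = K * s k * s k := by ring
      _ ≤ _ := mul_le_mul_of_nonneg_right (hsmall k) (hs k)
  have hle := le_of_tendsto_of_tendsto' (hlim.comp (Filter.tendsto_add_atTop_nat n))
    (hlim.const_mul (1 / 2)) hhalf
  have hnonneg : 0 ≤ ⨅ k, s k := le_ciInf hs
  have hzero : ⨅ k, s k = 0 := by linarith
  rwa [hzero] at hlim

lemma exists_isIteration (hK : 0 < K)
    (hex : ∀ (i : Fin n) (F : Matrix (Ctrl d) (Fin m) ℝ), K * blockSeminorm m d (F - G) ≤ 1 →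
      ∃ F', IsUpdate A B Q R i F F')
    (hest : ∀ (i : Fin n) (F F' : Matrix (Ctrl d) (Fin m) ℝ), K * blockSeminorm m d (F - G) ≤ 1 →
      IsUpdate A B Q R i F F' →
        ‖(blockCol d i)ᵀ * (F' - G)‖ ≤ K * blockSeminorm m d (F - G) ^ 2)
    (j : Fin n) {F₀ : Matrix (Ctrl d) (Fin m) ℝ} (h₀ : K * blockSeminorm m d (F₀ - G) ≤ 1) :
    ∃ F : ℕ → Matrix (Ctrl d) (Fin m) ℝ, F 0 = F₀ ∧ IsIteration A B Q R j F := by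
  -- Updates map this neighbourhood of `G` to itself, so the recursion can run inside it.
  let U := {F : Matrix (Ctrl d) (Fin m) ℝ // K * blockSeminorm m d (F - G) ≤ 1}
  have hstep : ∀ (i : Fin n) (F : U), ∃ F' : U, IsUpdate A B Q R i F.1 F'.1 := by
    rintro i ⟨F, hF⟩
    obtain ⟨F', hF'⟩ := hex i F hF
    have hs : 0 ≤ blockSeminorm m d (F - G) := apply_nonneg _ _
    have hle : blockSeminorm m d (F' - G) ≤ blockSeminorm m d (F - G) :=
      hF'.blockSeminorm_sub_le le_rfl ((hest i F F' hF hF').trans (by nlinarith))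
    exact ⟨⟨F', (mul_le_mul_of_nonneg_left hle hK.le).trans hF⟩, hF'⟩
  choose next hnext using hstep
  let F : ℕ → U := fun k => Nat.rec ⟨F₀, h₀⟩ (fun k F => next (cyclicIndex j k) F) k
  exact ⟨fun k => (F k).1, rfl, fun k => hnext (cyclicIndex j k) (F k)⟩

lemma IsIteration.unique (hQ : Q.PosDef) (hR : R.PosDef)
    {F F' : ℕ → Matrix (Ctrl d) (Fin m) ℝ} (hF : IsIteration A B Q R j F)
    (hF' : IsIteration A B Q R j F') (h₀ : F 0 = F' 0) : F = F' := by
  funext k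
  induction k with
  | zero => exact h₀
  | succ k ih => exact (hF k).unique hQ hR (ih ▸ hF' k)

end Iteration

end SplitLQR

/-! ### Transfer to an arbitrary norm -/

theorem theorem2 {m n : ℕ} (d : Fin n → ℕ)
    (A : Matrix (Fin m) (Fin m) ℝ) (B : Matrix (Fin m) (SplitLQR.Ctrl d) ℝ)
    (Q : Matrix (Fin m) (Fin m) ℝ) (R : Matrix (SplitLQR.Ctrl d) (SplitLQR.Ctrl d) ℝ)
    (hQ : Q.PosDef) (hR : R.PosDef)
    (hRblock : ∀ p q : SplitLQR.Ctrl d, p.1 ≠ q.1 → R p q = 0)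
    (Popt : Matrix (Fin m) (Fin m) ℝ) (hPopt : SplitLQR.IsCARESolution A B Q R Popt)
    (Fopt : Matrix (SplitLQR.Ctrl d) (Fin m) ℝ) (hFopt : Fopt = SplitLQR.feedback B R Popt)
    -- an arbitrary norm on the space of feedback matrices
    (N : Seminorm ℝ (Matrix (SplitLQR.Ctrl d) (Fin m) ℝ)) (hN : ∀ M, N M = 0 → M = 0) :
    ∃ C > 0, ∃ ε > 0, ∀ j : Fin n,
      -- the quadratic estimate for one cycle
      (∀ F : ℕ → Matrix (SplitLQR.Ctrl d) (Fin m) ℝ, SplitLQR.IsIteration A B Q R j F →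
        ∀ k : ℕ, N (F k - Fopt) < ε → N (F (k + n) - Fopt) ≤ C * N (F k - Fopt) ^ 2) ∧
      -- the iteration is well defined near the optimum, and converges
      (∀ F₀ : Matrix (SplitLQR.Ctrl d) (Fin m) ℝ, N (F₀ - Fopt) < ε →
        ∃! F : ℕ → Matrix (SplitLQR.Ctrl d) (Fin m) ℝ,
          F 0 = F₀ ∧ SplitLQR.IsIteration A B Q R j F) ∧
      (∀ F : ℕ → Matrix (SplitLQR.Ctrl d) (Fin m) ℝ, SplitLQR.IsIteration A B Q R j F →
        N (F 0 - Fopt) < ε →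
          Filter.Tendsto (fun k => N (F k - Fopt)) Filter.atTop (nhds 0)) := by
  obtain ⟨K, hK, hupd⟩ :=
    SplitLQR.exists_update_blockSeminorm_estimate hQ hR hRblock hPopt
  rw [← hFopt] at hupd
  obtain ⟨c₁, hc₁, hqN⟩ := SplitLQR.seminorm_le_mul_of_definite (SplitLQR.blockSeminorm m d) N hN
  obtain ⟨c₂, hc₂, hNq⟩ := SplitLQR.seminorm_le_mul_of_definite N (SplitLQR.blockSeminorm m d)
    fun M => SplitLQR.eq_zero_of_blockSeminorm_eq_zero
  have hex := fun i F hF => (hupd i F hF).1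
  have hest := fun i F F' hF => (hupd i F hF).2 F'
  -- The factor `2` in the radius provides the bound `1 / 2` that convergence needs; the cycle
  -- estimate needs only `1`.
  have hsmall : ∀ M, N M < 1 / (2 * K * c₁) → K * SplitLQR.blockSeminorm m d M ≤ 1 / 2 := by
    intro M hM
    rw [lt_div_iff₀ (by positivity)] at hM
    have := mul_le_mul_of_nonneg_left (hqN M) hK.le
    linarith
  refine ⟨c₂ * K * c₁ ^ 2, by positivity, 1 / (2 * K * c₁), by positivity, fun j =>
    ⟨fun F hF k hk => ?_, fun F₀ h₀ => ?_, fun F hF h₀ => ?_⟩⟩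
  · calc N (F (k + n) - Fopt) ≤ c₂ * SplitLQR.blockSeminorm m d (F (k + n) - Fopt) := hNq _
      _ ≤ c₂ * (K * SplitLQR.blockSeminorm m d (F k - Fopt) ^ 2) :=
          mul_le_mul_of_nonneg_left
            (hF.blockSeminorm_cycle_le hK hest (by linarith [hsmall _ hk])) hc₂.le
      _ ≤ c₂ * (K * (c₁ * N (F k - Fopt)) ^ 2) := by
          gcongr
          exact hqN _
      _ = c₂ * K * c₁ ^ 2 * N (F k - Fopt) ^ 2 := by ring
  · obtain ⟨F, hF0, hF⟩ := SplitLQR.exists_isIteration hK hex hest j (F₀ := F₀)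
      (by linarith [hsmall _ h₀])
    exact ⟨F, ⟨hF0, hF⟩, fun F' hF' => hF'.2.unique hQ hR hF (hF'.1.trans hF0.symm)⟩
  · have h := (hF.tendsto_blockSeminorm_sub hK hest (hsmall _ h₀)).const_mul c₂
    rw [mul_zero] at h
    exact squeeze_zero (fun k => apply_nonneg N _) (fun k => hNq _) h
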